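/- Let $A_1,A_2,A_3,A_4,A_5$ be strictly positive (that is, positive and invertible) bounded linear operators on a complex Hilbert space $\mathcal H$. Here $T\ge 0$ means $(Tx,x)\ge 0$ for all $x\in\mathcal H$, $S\ge T$ means that $(Sx,x)\ge (Tx,x)$ for all $x\in\mathcal H$ (for selfadjoint $S,T$), and real powers of strictly positive operators are taken in the continuous functional calculus. Then $$A_5\ge A_4\ge A_3\ge A_2\ge A_1$$ if and only if, for all real $p_1,p_2,p_3,p_4\ge 1$, all $t_1,t_2\in[0,1]$ and all real $r\ge t_2$, with $$\psi[4]=\{[(p_1-t_1)p_2+t_1]p_3-t_2\}p_4+t_2,$$ the following four inequalities all hold: $$A_5^{r-t_2}\ge\Big\{A_5^{\frac r2}\Big[A_4^{-\frac{t_2}2}\big(A_3^{\frac{t_1}2}(A_2^{-\frac{t_1}2}A_1^{p_1}A_2^{-\frac{t_1}2})^{p_2}A_3^{\frac{t_1}2}\big)^{p_3}A_4^{-\frac{t_2}2}\Big]^{p_4}A_5^{\frac r2}\Big\}^{\frac{r-t_2}{\psi[4]-t_2+r}},$$ $$A_5^{r-t_2}\ge\Big\{A_5^{\frac r2}\Big[A_5^{-\frac{t_2}2}\big(A_4^{\frac{t_1}2}(A_3^{-\frac{t_1}2}A_2^{p_1}A_3^{-\frac{t_1}2})^{p_2}A_4^{\frac{t_1}2}\big)^{p_3}A_5^{-\frac{t_2}2}\Big]^{p_4}A_5^{\frac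 r2}\Big\}^{\frac{r-t_2}{\psi[4]-t_2+r}},$$ $$A_1^{r-t_2}\le\Big\{A_1^{\frac r2}\Big[A_1^{-\frac{t_2}2}\big(A_2^{\frac{t_1}2}(A_3^{-\frac{t_1}2}A_4^{p_1}A_3^{-\frac{t_1}2})^{p_2}A_2^{\frac{t_1}2}\big)^{p_3}A_1^{-\frac{t_2}2}\Big]^{p_4}A_1^{\frac r2}\Big\}^{\frac{r-t_2}{\psi[4]-t_2+r}},$$ $$A_1^{r-t_2}\le\Big\{A_1^{\frac r2}\Big[A_2^{-\frac{t_2}2}\big(A_3^{\frac{t_1}2}(A_4^{-\frac{t_1}2}A_5^{p_1}A_4^{-\frac{t_1}2})^{p_2}A_3^{\frac{t_1}2}\big)^{p_3}A_2^{-\frac{t_2}2}\Big]^{p_4}A_1^{\frac r2}\Big\}^{\frac{r-t_2}{\psi[4]-t_2+r}}.$$ -/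

import Mathlib

/-- The exponent `ψ[4] = {[(p₁ - t₁) p₂ + t₁] p₃ - t₂} p₄ + t₂`. -/
def psiFour (p₁ p₂ p₃ p₄ t₁ t₂ : ℝ) : ℝ :=
  (((p₁ - t₁) * p₂ + t₁) * p₃ - t₂) * p₄ + t₂

section CStarAlgebra

variable {A : Type*} [CStarAlgebra A] [PartialOrder A] [StarOrderedRing A]

/-! Forward direction: for c ≤ b ≤ a, `grand_furuta_three` bounds a root of a two-level nested
expression by a. Applied to the inner levels, it gives D^(1/q) ≤ x₃ ≤ x₄ ≤ x₅, a new chain to which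
it applies again; a final use of the Furuta inequality (`rpow_conj_le_rpow`) produces the outer
exponent r - t₂. This is `nestedConj_le`; the two lower bounds by powers of A₁ follow by inverting
all operators, which reverses the chain.

Both Furuta-type inequalities are proved for a parameter in [1, 2] from the identity
`rpow_mul_star_self` and Löwner–Heinz monotonicity, then extended to [1, ∞) by multiplying
parameters.

Converse: at p₁ = t₁ = 1 the value of ψ[4] does not depend on p₂, so letting p₂ → ∞ keeps all powers
of x₂^(-1/2) x₁ x₂^(-1/2) bounded. This forces x₁ ≤ x₂, and each of the four inequalities yields one
link of the chain. -/

/-- A property holding on `[1, 2]` and stable under products holds on `[1, ∞)`. -/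
theorem one_le_mul_induction {P : ℝ → Prop} (base : ∀ s, 1 ≤ s → s ≤ 2 → P s)
    (mul : ∀ s u, 1 ≤ s → 1 ≤ u → P s → P u → P (s * u)) (s : ℝ) (hs : 1 ≤ s) : P s := by
  have key : ∀ n : ℕ, ∀ s : ℝ, 1 ≤ s → s ≤ 2 ^ n → P s := by
    intro n
    induction n with
    | zero => intro s h1 h2; exact base s h1 (by norm_num at h2; linarith)
    | succ n ih =>
      intro s h1 h2
      by_cases h : s ≤ 2
      · exact base s h1 h
      · have h3 : s = 2 * (s / 2) := by ring
        rw [h3]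
        refine mul _ _ (by norm_num) (by linarith) (base 2 (by norm_num) le_rfl) (ih _ ?_ ?_)
        · linarith
        · rw [pow_succ] at h2; linarith
  obtain ⟨n, hn⟩ := pow_unbounded_of_one_lt s (one_lt_two : (1 : ℝ) < 2)
  exact key n s hs hn.le

/-! ### Real powers and congruences of strictly positive elements. -/

theorem cfc_rpow_rpow {a : A} (ha : IsStrictlyPositive a) (x y : ℝ) :
    (a ^ x) ^ y = a ^ (x * y) := by
  by_cases hx : x = 0
  · subst hx
    rw [zero_mul, CFC.rpow_zero a ha.nonneg, CFC.one_rpow]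
  · exact CFC.rpow_rpow a x y hx ha

theorem star_cfc_rpow (a : A) (x : ℝ) : star (a ^ x) = a ^ x :=
  (IsSelfAdjoint.of_nonneg CFC.rpow_nonneg).star_eq

theorem isStrictlyPositive_mul_mul_star {w a : A} (hw : IsUnit w) (ha : IsStrictlyPositive a) :
    IsStrictlyPositive (w * a * star w) :=
  hw.isStrictlyPositive_star_right_conjugate_iff.2 ha

theorem isStrictlyPositive_rpow_conj {a b : A} (ha : IsStrictlyPositive a)
    (hb : IsStrictlyPositive b) (x : ℝ) : IsStrictlyPositive (a ^ x * b * a ^ x) := by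
  have := isStrictlyPositive_mul_mul_star (ha.isUnit.cfcRpow x ha.nonneg) hb
  rwa [star_cfc_rpow] at this

theorem rpow_conj_le_rpow_conj {b c : A} (h : b ≤ c) (a : A) (x : ℝ) :
    a ^ x * b * a ^ x ≤ a ^ x * c * a ^ x :=
  conjugate_le_conjugate_of_nonneg h CFC.rpow_nonneg

theorem rpow_conj_rpow_conj {a : A} (ha : IsStrictlyPositive a) (b : A) (x y : ℝ) :
    a ^ x * (a ^ y * b * a ^ y) * a ^ x = a ^ (x + y) * b * a ^ (x + y) := by
  rw [CFC.rpow_add ha.isUnit, ← CFC.rpow_add ha.isUnit, add_comm x y]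
  nth_rewrite 2 [CFC.rpow_add ha.isUnit]
  rw [add_comm y x, CFC.rpow_add ha.isUnit]
  simp only [mul_assoc]

theorem rpow_conj_rpow_neg_conj {a : A} (ha : IsStrictlyPositive a) (b : A) (x : ℝ) :
    a ^ x * (a ^ (-x) * b * a ^ (-x)) * a ^ x = b := by
  rw [rpow_conj_rpow_conj ha, add_neg_cancel, CFC.rpow_zero a ha.nonneg, one_mul, mul_one]

theorem rpow_neg_conj_rpow_conj {a : A} (ha : IsStrictlyPositive a) (b : A) (x : ℝ) :
    a ^ (-x) * (a ^ x * b * a ^ x) * a ^ (-x) = b := by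
  rw [rpow_conj_rpow_conj ha, neg_add_cancel, CFC.rpow_zero a ha.nonneg, one_mul, mul_one]

theorem rpow_conj_rpow {a : A} (ha : IsStrictlyPositive a) (x y : ℝ) :
    a ^ x * a ^ y * a ^ x = a ^ (x + y + x) := by
  rw [CFC.rpow_add ha.isUnit, CFC.rpow_add ha.isUnit]

theorem rpow_half_mul_rpow_half {a : A} (ha : IsStrictlyPositive a) (x : ℝ) :
    a ^ (x / 2) * a ^ (x / 2) = a ^ x := by
  rw [← CFC.rpow_add ha.isUnit, add_halves]

theorem rpow_antitone {p : ℝ} (hp : -1 ≤ p) (hp0 : p ≤ 0) {a b : A} (ha : IsStrictlyPositive a)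
    (hab : a ≤ b) : b ^ p ≤ a ^ p := by
  have hb : IsStrictlyPositive b := ha.of_le hab
  have h1 : a ^ (-p) ≤ b ^ (-p) := CFC.rpow_le_rpow ⟨by linarith, by linarith⟩ hab
  have h2 := CStarAlgebra.rpow_neg_one_le_rpow_neg_one h1 (ha.rpow a (-p))
  rwa [cfc_rpow_rpow ha, cfc_rpow_rpow hb, neg_mul_neg, mul_one] at h2

/-! ### Furuta's identity and the one-step power estimates. -/

theorem rpow_unitary_conj (u : unitary A) {a : A} (ha : IsStrictlyPositive a) (s : ℝ) :
    ((u : A) * a * star (u : A)) ^ s = u * a ^ s * star (u : A) := by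
  have hc : ContinuousOn (fun x : NNReal => x ^ s) (spectrum NNReal a) :=
    NNReal.continuousOn_rpow_const (.inl (spectrum.zero_notMem _ ha.isUnit))
  have hcont : Continuous (Unitary.conjStarAlgAut ℂ A u) := by
    have : (Unitary.conjStarAlgAut ℂ A u : A → A) = fun x => u * x * star (u : A) := by
      ext x; simp
    rw [this]; fun_prop
  have hpos : 0 ≤ (Unitary.conjStarAlgAut ℂ A u) a := by
    simpa using star_right_conjugate_nonneg ha.nonneg (u : A)
  have := StarAlgHomClass.map_cfc (S := ℂ) (Unitary.conjStarAlgAut ℂ A u)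
    (fun x : NNReal => x ^ s) a hc hcont ha.nonneg hpos
  simpa [CFC.rpow_def] using this.symm

/-- Furuta's identity `(z z⋆)ˢ = z (z⋆ z)ˢ⁻¹ z⋆` for invertible `z`. -/
theorem rpow_mul_star_self {z : A} (hz : IsUnit z) (s : ℝ) :
    (z * star z) ^ s = z * (star z * z) ^ (s - 1) * star z := by
  set b := star z * z with hb_def
  have hb : IsStrictlyPositive b := by
    have := isStrictlyPositive_mul_mul_star hz.star (isStrictlyPositive_one (A := A))
    simpa [hb_def] using this
  -- The unitary factor in the polar decomposition of `z`.
  set w := z * b ^ (-(1 / 2) : ℝ) with hw_def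
  have hwu : star w * w = 1 := by
    rw [hw_def, star_mul, star_cfc_rpow]
    calc b ^ (-(1 / 2) : ℝ) * star z * (z * b ^ (-(1 / 2) : ℝ))
        = b ^ (-(1 / 2) : ℝ) * b * b ^ (-(1 / 2) : ℝ) := by rw [hb_def]; noncomm_ring
      _ = 1 := by
        nth_rewrite 2 [← CFC.rpow_one b hb.nonneg]
        rw [rpow_conj_rpow hb]
        norm_num
        exact CFC.rpow_zero b hb.nonneg
  have hwunit : IsUnit w := hz.mul (hb.isUnit.cfcRpow _ hb.nonneg)
  have hwu' : w * star w = 1 := by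
    obtain ⟨v, hv⟩ := hwunit
    rw [← hv] at hwu ⊢
    rw [Units.mul_eq_one_iff_eq_inv.1 hwu, Units.mul_inv]
  have hzw : z = w * b ^ (1 / 2 : ℝ) := by
    rw [hw_def, mul_assoc, CFC.rpow_neg_mul_rpow _ hb, mul_one]
  have hsz : star z = b ^ (1 / 2 : ℝ) * star w := by rw [hzw, star_mul, star_cfc_rpow]
  have h1 : z * star z = w * b * star w := by
    rw [hsz, hzw]
    calc w * b ^ (1 / 2 : ℝ) * (b ^ (1 / 2 : ℝ) * star w)
        = w * (b ^ (1 / 2 : ℝ) * b ^ (1 / 2 : ℝ)) * star w := by noncomm_ring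
      _ = w * b * star w := by
        rw [rpow_half_mul_rpow_half hb, CFC.rpow_one b hb.nonneg]
  have h2 := rpow_unitary_conj ⟨w, Unitary.mem_iff.2 ⟨hwu, hwu'⟩⟩ hb s
  rw [h1]
  refine h2.trans ?_
  rw [hsz, hzw]
  calc w * b ^ s * star w
      = w * (b ^ (1 / 2 : ℝ) * b ^ (s - 1) * b ^ (1 / 2 : ℝ)) * star w := by
        rw [rpow_conj_rpow hb]; congr 3; ring
    _ = _ := by noncomm_ring

theorem conj_mul_star {w x : A} (hx : IsStrictlyPositive x) (p : ℝ) :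
    (w * x ^ (p / 2)) * star (w * x ^ (p / 2)) = w * x ^ p * star w := by
  rw [star_mul, star_cfc_rpow]
  calc w * x ^ (p / 2) * (x ^ (p / 2) * star w)
      = w * (x ^ (p / 2) * x ^ (p / 2)) * star w := by noncomm_ring
    _ = _ := by rw [rpow_half_mul_rpow_half hx]

theorem star_mul_conj {w x : A} (p : ℝ) :
    star (w * x ^ (p / 2)) * (w * x ^ (p / 2)) = x ^ (p / 2) * (star w * w) * x ^ (p / 2) := by
  rw [star_mul, star_cfc_rpow]; noncomm_ring

/-- Furuta's identity for the congruence `w xᵖ w⋆`. -/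
theorem rpow_conj_eq {w x : A} (hw : IsUnit w) (hx : IsStrictlyPositive x) (p s : ℝ) :
    (w * x ^ p * star w) ^ s =
      w * (x ^ (p / 2) * (x ^ (p / 2) * (star w * w) * x ^ (p / 2)) ^ (s - 1) * x ^ (p / 2)) *
        star w := by
  rw [← conj_mul_star hx, rpow_mul_star_self (hw.mul (hx.isUnit.cfcRpow _ hx.nonneg)),
    star_mul_conj, star_mul, star_cfc_rpow]
  noncomm_ring

/-- If `w⋆ w ≤ x⁻ᵗ`, then powers of `w xᵖ w⋆` with exponent `s ∈ [1, 2]` are dominated by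
`w xᑫ w⋆` with `q = (p - t) s + t`. -/
theorem rpow_conj_le_of_le {w x : A} (hw : IsUnit w) (hx : IsStrictlyPositive x) {p t s : ℝ}
    (h : star w * w ≤ x ^ (-t)) (hs1 : 1 ≤ s) (hs2 : s ≤ 2) :
    (w * x ^ p * star w) ^ s ≤ w * x ^ ((p - t) * s + t) * star w := by
  rw [rpow_conj_eq hw hx]
  refine star_right_conjugate_le_conjugate ?_ w
  have h1 := rpow_conj_le_rpow_conj h x (p / 2)
  rw [rpow_conj_rpow hx] at h1
  -- Löwner–Heinz: s - 1 lies in [0, 1].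
  have h2 := rpow_conj_le_rpow_conj
    (CFC.rpow_le_rpow (p := s - 1) ⟨by linarith, by linarith⟩ h1) x (p / 2)
  rw [cfc_rpow_rpow hx, rpow_conj_rpow hx] at h2
  refine h2.trans_eq ?_
  congr 1; ring

/-- If `xᵗ ≤ w⋆ w`, then powers of `w xᵖ w⋆` with exponent in `[0, 1]` are dominated by
`w xᑫ w⋆` with `q = (p + t) s - t`. -/
theorem rpow_conj_le_of_ge {w x : A} (hw : IsUnit w) (hx : IsStrictlyPositive x) {p t s : ℝ}
    (h : x ^ t ≤ star w * w) (hs0 : 0 ≤ s) (hs1 : s ≤ 1) :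
    (w * x ^ p * star w) ^ s ≤ w * x ^ ((p + t) * s - t) * star w := by
  rw [rpow_conj_eq hw hx]
  refine star_right_conjugate_le_conjugate ?_ w
  have h1 := rpow_conj_le_rpow_conj h x (p / 2)
  -- Here s - 1 lies in [-1, 0], so the power reverses the order.
  have h2 := rpow_conj_le_rpow_conj
    (rpow_antitone (p := s - 1) (by linarith) (by linarith)
      (isStrictlyPositive_rpow_conj hx (hx.rpow x t) _) h1) x (p / 2)
  rw [rpow_conj_rpow hx, cfc_rpow_rpow hx, rpow_conj_rpow hx] at h2
  refine h2.trans_eq ?_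
  congr 1; ring

/-! ### The Furuta and grand Furuta inequalities. -/

/-- The Furuta inequality for invertible operators, with `u = 1 + r`. -/
theorem furuta_inequality (u : ℝ) (hu : 1 ≤ u) : ∀ (a b : A) (p : ℝ), IsStrictlyPositive b →
    b ≤ a → 1 ≤ p →
      (a ^ ((u - 1) / 2) * b ^ p * a ^ ((u - 1) / 2)) ^ (u / (p + u - 1)) ≤ a ^ u := by
  refine one_le_mul_induction (P := fun u => ∀ (a b : A) (p : ℝ), IsStrictlyPositive b →
    b ≤ a → 1 ≤ p →
      (a ^ ((u - 1) / 2) * b ^ p * a ^ ((u - 1) / 2)) ^ (u / (p + u - 1)) ≤ a ^ u) ?_ ?_ u hu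
  · intro u h1 h2 a b p hb hab hp
    have ha : IsStrictlyPositive a := hb.of_le hab
    have hd : 0 < p + u - 1 := by linarith
    -- The exponent is chosen so that `b` comes out with power 1; b^(u-1) ≤ a^(u-1) needs u ≤ 2.
    have h := rpow_conj_le_of_ge (w := a ^ ((u - 1) / 2)) (t := u - 1) (p := p)
      (s := u / (p + u - 1)) (ha.isUnit.cfcRpow _ ha.nonneg) hb
      (by
        rw [star_cfc_rpow, rpow_half_mul_rpow_half ha]
        exact CFC.rpow_le_rpow ⟨by linarith, by linarith⟩ hab)
      (by positivity) (by rw [div_le_one hd]; linarith)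
    rw [star_cfc_rpow] at h
    refine h.trans ?_
    have e : (p + (u - 1)) * (u / (p + u - 1)) - (u - 1) = 1 := by field_simp; ring
    rw [e, CFC.rpow_one b hb.nonneg]
    refine (rpow_conj_le_rpow_conj hab a _).trans_eq ?_
    nth_rewrite 2 [← CFC.rpow_one a ha.nonneg]
    rw [rpow_conj_rpow ha]
    congr 1; ring
  · intro u v hu hv ihu ihv a b p hb hab hp
    have ha : IsStrictlyPositive a := hb.of_le hab
    have hd : 0 < p + u - 1 := by linarith
    have hpos : IsStrictlyPositive (a ^ ((u - 1) / 2) * b ^ p * a ^ ((u - 1) / 2)) :=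
      isStrictlyPositive_rpow_conj ha (hb.rpow b p) _
    -- The case `u` is itself an operator inequality with larger side `a ^ u`; the power (p + u -
    -- 1)/u undoes its outer exponent.
    have h := ihv (a ^ u) _ ((p + u - 1) / u) (hpos.rpow _ _) (ihu a b p hb hab hp)
      (by rw [le_div_iff₀ (by linarith)]; linarith)
    have e : u / (p + u - 1) * ((p + u - 1) / u) = 1 := by field_simp
    rw [cfc_rpow_rpow hpos, e, CFC.rpow_one _ hpos.nonneg, cfc_rpow_rpow ha, cfc_rpow_rpow ha,
      rpow_conj_rpow_conj ha] at h
    have e1 : u * ((v - 1) / 2) + (u - 1) / 2 = (u * v - 1) / 2 := by ring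
    have e2 : v / ((p + u - 1) / u + v - 1) = u * v / (p + u * v - 1) := by
      have : 0 < (p + u - 1) / u + v - 1 := by
        have : 0 < (p + u - 1) / u := by positivity
        linarith
      have : 0 < p + u * v - 1 := by nlinarith
      have h0 : u ≠ 0 := by linarith
      rw [div_eq_div_iff (by positivity) (by positivity)]
      field_simp
      ring
    rwa [e1, e2] at h

/-- The form of the Furuta inequality with `aʳ` on the larger side. -/
theorem rpow_conj_le_rpow {a b : A} {p r : ℝ} (hb : IsStrictlyPositive b) (hab : b ≤ a)
    (hp : 1 ≤ p) (hr : 0 ≤ r) :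
    (a ^ (r / 2) * b ^ p * a ^ (r / 2)) ^ (r / (p + r)) ≤ a ^ r := by
  have ha : IsStrictlyPositive a := hb.of_le hab
  have h := furuta_inequality (1 + r) (by linarith) a b p hb hab hp
  have h1 := CFC.rpow_le_rpow (p := r / (1 + r))
    ⟨by positivity, by rw [div_le_one (by linarith)]; linarith⟩ h
  have hpos := isStrictlyPositive_rpow_conj ha (hb.rpow b p) ((1 + r - 1) / 2)
  rw [cfc_rpow_rpow hpos, cfc_rpow_rpow ha] at h1
  have e1 : (1 + r - 1) / 2 = r / 2 := by ring
  have e2 : (1 + r) / (p + (1 + r) - 1) * (r / (1 + r)) = r / (p + r) := by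
    have : 0 < p + r := by linarith
    have e : p + (1 + r) - 1 = p + r := by ring
    rw [e]; field_simp
  have e3 : (1 + r) * (r / (1 + r)) = r := by field_simp
  rwa [e1, e2, e3] at h1

/-- A grand Furuta type inequality for three operators `c ≤ b ≤ a`. -/
theorem grand_furuta_three {t : ℝ} (ht0 : 0 ≤ t) (ht1 : t ≤ 1) (s : ℝ) (hs : 1 ≤ s) :
    ∀ (a b c : A) (p : ℝ), IsStrictlyPositive c → c ≤ b → b ≤ a → 1 ≤ p →
      (a ^ (t / 2) * (b ^ (-(t / 2)) * c ^ p * b ^ (-(t / 2))) ^ s * a ^ (t / 2)) ^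
        (1 / ((p - t) * s + t)) ≤ a := by
  refine one_le_mul_induction
    (P := fun s => ∀ (a b c : A) (p : ℝ), IsStrictlyPositive c → c ≤ b → b ≤ a → 1 ≤ p →
      (a ^ (t / 2) * (b ^ (-(t / 2)) * c ^ p * b ^ (-(t / 2))) ^ s * a ^ (t / 2)) ^
        (1 / ((p - t) * s + t)) ≤ a) ?_ ?_ s hs
  · intro s hs1 hs2 a b c p hc hcb hba hp
    have hb : IsStrictlyPositive b := hc.of_le hcb
    have ha : IsStrictlyPositive a := hb.of_le hba
    have hq : 1 ≤ (p - t) * s + t := by nlinarith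
    set q := (p - t) * s + t with hq_def
    have h1 := rpow_conj_le_of_le (w := b ^ (-(t / 2))) (x := c) (p := p) (t := t)
      (hb.isUnit.cfcRpow _ hb.nonneg) hc
      (by
        rw [star_cfc_rpow, ← CFC.rpow_add hb.isUnit]
        have e : -(t / 2) + -(t / 2) = -t := by ring
        rw [e]
        exact rpow_antitone (by linarith) (by linarith) hc hcb) hs1 hs2
    rw [star_cfc_rpow] at h1
    have hq0 : 0 ≤ 1 / q := by positivity
    have hq1 : 1 / q ≤ 1 := by rw [div_le_one (by linarith)]; exact hq
    have h2 := CFC.rpow_le_rpow ⟨hq0, hq1⟩ (rpow_conj_le_rpow_conj h1 a (t / 2))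
    refine h2.trans ?_
    have hw : IsUnit (a ^ (t / 2) * b ^ (-(t / 2))) :=
      (ha.isUnit.cfcRpow _ ha.nonneg).mul (hb.isUnit.cfcRpow _ hb.nonneg)
    -- Since w⋆ w ≥ 1 for w = a^(t/2) b^(-t/2), the root 1/q may be moved inside the congruence.
    have hexp : (1 : A) ≤ star (a ^ (t / 2) * b ^ (-(t / 2))) * (a ^ (t / 2) * b ^ (-(t / 2))) := by
      have h3 := rpow_conj_le_rpow_conj (CFC.rpow_le_rpow ⟨ht0, ht1⟩ hba) b (-(t / 2))
      rw [rpow_conj_rpow hb] at h3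
      have e : -(t / 2) + t + -(t / 2) = 0 := by ring
      rw [e, CFC.rpow_zero b hb.nonneg, ← rpow_half_mul_rpow_half ha] at h3
      refine h3.trans_eq ?_
      rw [star_mul, star_cfc_rpow, star_cfc_rpow]
      noncomm_ring
    have h4 := rpow_conj_le_of_ge (p := q) (t := 0) (s := 1 / q) hw hc
      (by rw [CFC.rpow_zero c hc.nonneg]; exact hexp) hq0 hq1
    have e : (q + 0) * (1 / q) - 0 = 1 := by field_simp; ring
    rw [e, CFC.rpow_one c hc.nonneg, star_mul, star_cfc_rpow, star_cfc_rpow] at h4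
    have h5 : a ^ (t / 2) * (b ^ (-(t / 2)) * c * b ^ (-(t / 2))) * a ^ (t / 2) ≤ a := by
      have h6 := rpow_conj_le_rpow_conj hcb b (-(t / 2))
      have e : b ^ (-(t / 2)) * b * b ^ (-(t / 2)) = b ^ (1 - t) := by
        have := rpow_conj_rpow hb (-(t / 2)) 1
        rw [CFC.rpow_one b hb.nonneg] at this
        rw [this]; congr 1; ring
      rw [e] at h6
      have h7 := h6.trans
        (CFC.rpow_le_rpow (p := 1 - t) ⟨by linarith, by linarith⟩ hba)
      refine (rpow_conj_le_rpow_conj h7 a (t / 2)).trans_eq ?_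
      rw [rpow_conj_rpow ha]
      have e : t / 2 + (1 - t) + t / 2 = 1 := by ring
      rw [e, CFC.rpow_one a ha.nonneg]
    refine le_trans (le_of_eq_of_le ?_ h4) (le_of_eq_of_le ?_ h5)
    · simp only [mul_assoc]; rfl
    · simp only [mul_assoc]
  · intro s v hs hv ihs ihv a b c p hc hcb hba hp
    have hb : IsStrictlyPositive b := hc.of_le hcb
    have hq : 1 ≤ (p - t) * s + t := by nlinarith
    set q := (p - t) * s + t with hq_def
    have hin := isStrictlyPositive_rpow_conj hb (hc.rpow c p) (-(t / 2))
    have hpos := isStrictlyPositive_rpow_conj hb (hin.rpow _ s) (t / 2)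
    -- Taking `a = b` in the case `s` makes the outer factors b^(t/2) cancel against b^(-t/2), so
    -- the exponents `s` and `v` multiply.
    have h := ihv a b _ q (hpos.rpow _ (1 / q)) (ihs b b c p hc hcb le_rfl hp) hba hq
    have e : 1 / q * q = 1 := by field_simp
    have e2 : (q - t) * v + t = (p - t) * (s * v) + t := by rw [hq_def]; ring
    rwa [cfc_rpow_rpow hpos, e, CFC.rpow_one _ hpos.nonneg, rpow_neg_conj_rpow_conj hb,
      cfc_rpow_rpow hin, e2] at h

/-! ### The forward inequality for a chain of five elements. -/

/-- The nested expression
`{x₅^{r/2} [x₄^{-t₂/2} (x₃^{t₁/2} (x₂^{-t₁/2} x₁^{p₁} x₂^{-t₁/2})^{p₂} x₃^{t₁/2})^{p₃}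
x₄^{-t₂/2}]^{p₄} x₅^{r/2}}^e`. -/
noncomputable def nestedConj (x₁ x₂ x₃ x₄ x₅ : A) (p₁ p₂ p₃ p₄ t₁ t₂ r e : ℝ) : A :=
  (x₅ ^ (r / 2) *
    (x₄ ^ (-(t₂ / 2)) *
      (x₃ ^ (t₁ / 2) *
        (x₂ ^ (-(t₁ / 2)) * x₁ ^ p₁ * x₂ ^ (-(t₁ / 2))) ^ p₂ *
        x₃ ^ (t₁ / 2)) ^ p₃ *
      x₄ ^ (-(t₂ / 2))) ^ p₄ *
    x₅ ^ (r / 2)) ^ e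

theorem nestedConj_le {x₁ x₂ x₃ x₄ x₅ : A} (h : IsStrictlyPositive x₁) (h₁₂ : x₁ ≤ x₂)
    (h₂₃ : x₂ ≤ x₃) (h₃₄ : x₃ ≤ x₄) (h₄₅ : x₄ ≤ x₅) {p₁ p₂ p₃ p₄ t₁ t₂ r : ℝ}
    (hp₁ : 1 ≤ p₁) (hp₂ : 1 ≤ p₂) (hp₃ : 1 ≤ p₃) (hp₄ : 1 ≤ p₄)
    (ht₁ : t₁ ∈ Set.Icc (0 : ℝ) 1) (ht₂ : t₂ ∈ Set.Icc (0 : ℝ) 1) (hr : t₂ ≤ r) :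
    nestedConj x₁ x₂ x₃ x₄ x₅ p₁ p₂ p₃ p₄ t₁ t₂ r
      ((r - t₂) / (psiFour p₁ p₂ p₃ p₄ t₁ t₂ - t₂ + r)) ≤ x₅ ^ (r - t₂) := by
  obtain ⟨ht₁0, ht₁1⟩ := ht₁
  obtain ⟨ht₂0, ht₂1⟩ := ht₂
  have hx₂ := h.of_le h₁₂
  have hx₃ := hx₂.of_le h₂₃
  have hx₄ := hx₃.of_le h₃₄
  have hx₅ := hx₄.of_le h₄₅
  have hq : 1 ≤ (p₁ - t₁) * p₂ + t₁ := by nlinarith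
  have hin₁ := isStrictlyPositive_rpow_conj hx₃
    ((isStrictlyPositive_rpow_conj hx₂ (h.rpow x₁ p₁) (-(t₁ / 2))).rpow _ p₂) (t₁ / 2)
  have hE := grand_furuta_three ht₁0 ht₁1 p₂ hp₂ x₃ x₂ x₁ p₁ h h₁₂ h₂₃ hp₁
  have hψ : psiFour p₁ p₂ p₃ p₄ t₁ t₂ = (((p₁ - t₁) * p₂ + t₁) * p₃ - t₂) * p₄ + t₂ := rfl
  unfold nestedConj
  set q := (p₁ - t₁) * p₂ + t₁ with hq_def
  set D := x₃ ^ (t₁ / 2) * (x₂ ^ (-(t₁ / 2)) * x₁ ^ p₁ * x₂ ^ (-(t₁ / 2))) ^ p₂ * x₃ ^ (t₁ / 2)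
    with hD
  have hqp : 1 ≤ q * p₃ := by nlinarith
  have hψ1 : 1 ≤ (q * p₃ - t₂) * p₄ + t₂ := by nlinarith
  -- The first bound makes D^(1/q) the bottom of a new chain; its power q p₃ is D^p₃.
  have hF := grand_furuta_three ht₂0 ht₂1 p₄ hp₄ x₅ x₄ _ (q * p₃) (hin₁.rpow D (1 / q))
    (hE.trans h₃₄) h₄₅ hqp
  have e1 : 1 / q * (q * p₃) = p₃ := by field_simp
  rw [cfc_rpow_rpow hin₁, e1, ← hψ] at hF
  rw [← hψ] at hψ1
  set ψ := psiFour p₁ p₂ p₃ p₄ t₁ t₂ with hψ_def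
  have hin₂ := (isStrictlyPositive_rpow_conj hx₄ (hin₁.rpow D p₃) (-(t₂ / 2))).rpow _ p₄
  set M := (x₄ ^ (-(t₂ / 2)) * D ^ p₃ * x₄ ^ (-(t₂ / 2))) ^ p₄ with hM
  have hin₃ := isStrictlyPositive_rpow_conj hx₅ hin₂ (t₂ / 2)
  -- Conjugating by x₅^((r - t₂)/2) completes x₅^(t₂/2) to x₅^(r/2).
  have hfin := rpow_conj_le_rpow (r := r - t₂) (hin₃.rpow _ (1 / ψ)) hF hψ1 (by linarith)
  have e2 : 1 / ψ * ψ = 1 := by field_simp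
  have e3 : (r - t₂) / 2 + t₂ / 2 = r / 2 := by ring
  have e4 : ψ + (r - t₂) = ψ - t₂ + r := by ring
  rwa [cfc_rpow_rpow hin₃, e2, CFC.rpow_one _ hin₃.nonneg, rpow_conj_rpow_conj hx₅, e3, e4] at hfin

/-! ### Behaviour under inversion. -/

theorem rpow_neg_one_rpow {a : A} (ha : IsStrictlyPositive a) (x : ℝ) :
    (a ^ (-1 : ℝ)) ^ x = (a ^ x) ^ (-1 : ℝ) := by
  rw [cfc_rpow_rpow ha, cfc_rpow_rpow ha, mul_comm]

theorem rpow_conj_rpow_neg_one {a b : A} (ha : IsStrictlyPositive a) (hb : IsStrictlyPositive b)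
    (x : ℝ) :
    (a ^ x * b * a ^ x) ^ (-1 : ℝ) =
      (a ^ (-1 : ℝ)) ^ x * b ^ (-1 : ℝ) * (a ^ (-1 : ℝ)) ^ x := by
  have hax := ha.rpow a x
  rw [← CFC.inverse_eq_rpow_neg_one (isStrictlyPositive_rpow_conj ha hb x),
    rpow_neg_one_rpow ha, ← CFC.inverse_eq_rpow_neg_one hax, ← CFC.inverse_eq_rpow_neg_one hb]
  obtain ⟨u, hu⟩ := hax.isUnit
  obtain ⟨v, hv⟩ := hb.isUnit
  rw [← hu, ← hv, ← Units.val_mul, ← Units.val_mul]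
  rw [Ring.inverse_unit, Ring.inverse_unit, Ring.inverse_unit]
  simp only [mul_inv_rev, Units.val_mul, mul_assoc]

theorem nestedConj_rpow_neg_one {x₁ x₂ x₃ x₄ x₅ : A} (h₁ : IsStrictlyPositive x₁)
    (h₂ : IsStrictlyPositive x₂) (h₃ : IsStrictlyPositive x₃) (h₄ : IsStrictlyPositive x₄)
    (h₅ : IsStrictlyPositive x₅) (p₁ p₂ p₃ p₄ t₁ t₂ r e : ℝ) :
    nestedConj (x₁ ^ (-1 : ℝ)) (x₂ ^ (-1 : ℝ)) (x₃ ^ (-1 : ℝ)) (x₄ ^ (-1 : ℝ)) (x₅ ^ (-1 : ℝ))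
      p₁ p₂ p₃ p₄ t₁ t₂ r e = (nestedConj x₁ x₂ x₃ x₄ x₅ p₁ p₂ p₃ p₄ t₁ t₂ r e) ^ (-1 : ℝ) := by
  have g₁ := h₁.rpow _ p₁
  have g₂ := isStrictlyPositive_rpow_conj h₂ g₁ (-(t₁ / 2))
  have g₂' := g₂.rpow _ p₂
  have g₃ := isStrictlyPositive_rpow_conj h₃ g₂' (t₁ / 2)
  have g₃' := g₃.rpow _ p₃
  have g₄ := isStrictlyPositive_rpow_conj h₄ g₃' (-(t₂ / 2))
  have g₄' := g₄.rpow _ p₄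
  have g₅ := isStrictlyPositive_rpow_conj h₅ g₄' (r / 2)
  unfold nestedConj
  rw [rpow_neg_one_rpow h₁, ← rpow_conj_rpow_neg_one h₂ g₁, rpow_neg_one_rpow g₂,
    ← rpow_conj_rpow_neg_one h₃ g₂', rpow_neg_one_rpow g₃, ← rpow_conj_rpow_neg_one h₄ g₃',
    rpow_neg_one_rpow g₄, ← rpow_conj_rpow_neg_one h₅ g₄', rpow_neg_one_rpow g₅]

theorem isStrictlyPositive_nestedConj {x₁ x₂ x₃ x₄ x₅ : A} (h₁ : IsStrictlyPositive x₁)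
    (h₂ : IsStrictlyPositive x₂) (h₃ : IsStrictlyPositive x₃) (h₄ : IsStrictlyPositive x₄)
    (h₅ : IsStrictlyPositive x₅) (p₁ p₂ p₃ p₄ t₁ t₂ r e : ℝ) :
    IsStrictlyPositive (nestedConj x₁ x₂ x₃ x₄ x₅ p₁ p₂ p₃ p₄ t₁ t₂ r e) :=
  (isStrictlyPositive_rpow_conj h₅ ((isStrictlyPositive_rpow_conj h₄
    ((isStrictlyPositive_rpow_conj h₃ ((isStrictlyPositive_rpow_conj h₂
      (h₁.rpow _ p₁) _).rpow _ p₂) _).rpow _ p₃) _).rpow _ p₄) _).rpow _ e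

theorem rpow_neg_one_le_iff {a b : A} (ha : IsStrictlyPositive a) (hb : IsStrictlyPositive b) :
    b ^ (-1 : ℝ) ≤ a ^ (-1 : ℝ) ↔ a ≤ b := by
  refine ⟨fun h => ?_, fun h => CStarAlgebra.rpow_neg_one_le_rpow_neg_one h ha⟩
  have := CStarAlgebra.rpow_neg_one_le_rpow_neg_one h (hb.rpow b _)
  rwa [cfc_rpow_rpow ha, cfc_rpow_rpow hb, neg_mul_neg, one_mul, CFC.rpow_one a ha.nonneg,
    CFC.rpow_one b hb.nonneg] at this

/-- The inequality for the chain and for the chain of inverses are order reversals of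
each other. -/
theorem le_nestedConj_iff {x₁ x₂ x₃ x₄ x₅ : A} (h₁ : IsStrictlyPositive x₁)
    (h₂ : IsStrictlyPositive x₂) (h₃ : IsStrictlyPositive x₃) (h₄ : IsStrictlyPositive x₄)
    (h₅ : IsStrictlyPositive x₅) (p₁ p₂ p₃ p₄ t₁ t₂ r e y : ℝ) :
    x₅ ^ y ≤ nestedConj x₁ x₂ x₃ x₄ x₅ p₁ p₂ p₃ p₄ t₁ t₂ r e ↔
      nestedConj (x₁ ^ (-1 : ℝ)) (x₂ ^ (-1 : ℝ)) (x₃ ^ (-1 : ℝ)) (x₄ ^ (-1 : ℝ)) (x₅ ^ (-1 : ℝ))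
        p₁ p₂ p₃ p₄ t₁ t₂ r e ≤ (x₅ ^ (-1 : ℝ)) ^ y := by
  rw [nestedConj_rpow_neg_one h₁ h₂ h₃ h₄ h₅, rpow_neg_one_rpow h₅,
    rpow_neg_one_le_iff (h₅.rpow _ y) (isStrictlyPositive_nestedConj h₁ h₂ h₃ h₄ h₅ ..)]

/-! ### Recovering the order from the inequalities. -/

/-- A strictly positive element whose powers `mˢ`, `s ≥ 1`, are bounded is at most `1`. -/
theorem le_one_of_rpow_bounded {m : A} (hm : IsStrictlyPositive m) {c : ℝ}
    (h : ∀ s : ℝ, 1 ≤ s → ‖m ^ s‖ ≤ c) : m ≤ 1 := by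
  rw [← CStarAlgebra.norm_le_one_iff_of_nonneg m hm.nonneg]
  by_contra! hlt
  obtain ⟨n, hn⟩ := pow_unbounded_of_one_lt c hlt
  have h1 := h (n + 1) (by linarith [n.cast_nonneg (α := ℝ)])
  rw [CFC.norm_rpow m (by positivity) hm.nonneg] at h1
  have h2 : ‖m‖ ^ n ≤ ‖m‖ ^ ((n : ℝ) + 1) := by
    rw [← Real.rpow_natCast]
    exact Real.rpow_le_rpow_of_exponent_le hlt.le (by linarith)
  linarith

/-- Only the free exponent `s` varies: the right-hand side and the outer exponent stay fixed, so the
innermost power is bounded uniformly in `s`. -/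
theorem le_of_nestedConj_le {x₁ x₂ x₃ x₄ x₅ : A} (h₁ : IsStrictlyPositive x₁)
    (h₂ : IsStrictlyPositive x₂) (h₃ : IsStrictlyPositive x₃) (h₄ : IsStrictlyPositive x₄)
    (h₅ : IsStrictlyPositive x₅)
    (h : ∀ s : ℝ, 1 ≤ s → nestedConj x₁ x₂ x₃ x₄ x₅ 1 s 1 1 1 0 1
      ((1 - 0) / (psiFour 1 s 1 1 1 0 - 0 + 1)) ≤ x₅ ^ (1 - 0 : ℝ)) : x₁ ≤ x₂ := by
  have hm := isStrictlyPositive_rpow_conj h₂ h₁ (-(1 / 2))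
  set m := x₂ ^ (-(1 / 2) : ℝ) * x₁ * x₂ ^ (-(1 / 2) : ℝ) with hm_def
  have hm1 : m ≤ 1 := by
    -- The bound comes from squaring the norm estimate and undoing the conjugations by x₅^(1/2) and
    -- x₃^(1/2).
    refine le_one_of_rpow_bounded (c := ‖x₃ ^ (-(1 / 2) : ℝ)‖ *
      (‖x₅ ^ (-(1 / 2) : ℝ)‖ * ‖x₅‖ ^ (2 : ℝ) * ‖x₅ ^ (-(1 / 2) : ℝ)‖) *
      ‖x₃ ^ (-(1 / 2) : ℝ)‖) hm fun s hs => ?_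
    have hg := isStrictlyPositive_rpow_conj h₃ (hm.rpow m s) (1 / 2)
    have hk := isStrictlyPositive_rpow_conj h₅ hg (1 / 2)
    have hks := h s hs
    -- Because p₁ - t₁ = 0, ψ[4] = 1 for every `s`.
    have e : (1 - 0 : ℝ) / (psiFour 1 s 1 1 1 0 - 0 + 1) = 1 / 2 := by
      unfold psiFour; norm_num
    rw [e] at hks
    unfold nestedConj at hks
    rw [CFC.rpow_one x₁ h₁.nonneg, ← hm_def, CFC.rpow_one _ hg.nonneg, zero_div, neg_zero,
      CFC.rpow_zero x₄ h₄.nonneg, one_mul, mul_one, CFC.rpow_one _ hg.nonneg, sub_zero,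
      CFC.rpow_one x₅ h₅.nonneg] at hks
    have hn := CStarAlgebra.norm_le_norm_of_nonneg_of_le (hk.rpow _ _).nonneg hks
    rw [CFC.norm_rpow _ (by norm_num) hk.nonneg] at hn
    set k := x₅ ^ (1 / 2 : ℝ) * (x₃ ^ (1 / 2 : ℝ) * m ^ s * x₃ ^ (1 / 2 : ℝ)) * x₅ ^ (1 / 2 : ℝ)
      with hk_def
    have hn2 : ‖k‖ ≤ ‖x₅‖ ^ (2 : ℝ) := by
      have := Real.rpow_le_rpow (by positivity) hn (by norm_num : (0 : ℝ) ≤ 2)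
      rwa [← Real.rpow_mul (norm_nonneg _), show (1 / 2 : ℝ) * 2 = 1 by norm_num,
        Real.rpow_one] at this
    have hms : m ^ s = x₃ ^ (-(1 / 2) : ℝ) *
        (x₅ ^ (-(1 / 2) : ℝ) * k * x₅ ^ (-(1 / 2) : ℝ)) * x₃ ^ (-(1 / 2) : ℝ) := by
      rw [hk_def, rpow_neg_conj_rpow_conj h₅, rpow_neg_conj_rpow_conj h₃]
    rw [hms]
    refine (norm_mul₃_le).trans ?_
    gcongr
    exact (norm_mul₃_le).trans (by gcongr)
  have h' := rpow_conj_le_rpow_conj hm1 x₂ (1 / 2)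
  rw [hm_def, rpow_conj_rpow_neg_conj h₂, mul_one, rpow_half_mul_rpow_half h₂,
    CFC.rpow_one x₂ h₂.nonneg] at h'
  exact h'

end CStarAlgebra

theorem proposition2p1 {H : Type*} [NormedAddCommGroup H] [InnerProductSpace ℂ H]
    [CompleteSpace H] (A₁ A₂ A₃ A₄ A₅ : H →L[ℂ] H)
    (h₁ : IsStrictlyPositive A₁) (h₂ : IsStrictlyPositive A₂) (h₃ : IsStrictlyPositive A₃)
    (h₄ : IsStrictlyPositive A₄) (h₅ : IsStrictlyPositive A₅) :
    (A₅ ≥ A₄ ∧ A₄ ≥ A₃ ∧ A₃ ≥ A₂ ∧ A₂ ≥ A₁) ↔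
      ∀ p₁ p₂ p₃ p₄ t₁ t₂ r : ℝ, 1 ≤ p₁ → 1 ≤ p₂ → 1 ≤ p₃ → 1 ≤ p₄ →
        t₁ ∈ Set.Icc (0 : ℝ) 1 → t₂ ∈ Set.Icc (0 : ℝ) 1 → t₂ ≤ r →
        A₅ ^ (r - t₂) ≥
            (A₅ ^ (r / 2) *
              (A₄ ^ (-(t₂ / 2)) *
                (A₃ ^ (t₁ / 2) *
                  (A₂ ^ (-(t₁ / 2)) * A₁ ^ p₁ * A₂ ^ (-(t₁ / 2))) ^ p₂ *
                  A₃ ^ (t₁ / 2)) ^ p₃ *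
                A₄ ^ (-(t₂ / 2))) ^ p₄ *
              A₅ ^ (r / 2)) ^ ((r - t₂) / (psiFour p₁ p₂ p₃ p₄ t₁ t₂ - t₂ + r)) ∧
        A₅ ^ (r - t₂) ≥
            (A₅ ^ (r / 2) *
              (A₅ ^ (-(t₂ / 2)) *
                (A₄ ^ (t₁ / 2) *
                  (A₃ ^ (-(t₁ / 2)) * A₂ ^ p₁ * A₃ ^ (-(t₁ / 2))) ^ p₂ *
                  A₄ ^ (t₁ / 2)) ^ p₃ *
                A₅ ^ (-(t₂ / 2))) ^ p₄ *
              A₅ ^ (r / 2)) ^ ((r - t₂) / (psiFour p₁ p₂ p₃ p₄ t₁ t₂ - t₂ + r)) ∧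
        A₁ ^ (r - t₂) ≤
            (A₁ ^ (r / 2) *
              (A₁ ^ (-(t₂ / 2)) *
                (A₂ ^ (t₁ / 2) *
                  (A₃ ^ (-(t₁ / 2)) * A₄ ^ p₁ * A₃ ^ (-(t₁ / 2))) ^ p₂ *
                  A₂ ^ (t₁ / 2)) ^ p₃ *
                A₁ ^ (-(t₂ / 2))) ^ p₄ *
              A₁ ^ (r / 2)) ^ ((r - t₂) / (psiFour p₁ p₂ p₃ p₄ t₁ t₂ - t₂ + r)) ∧
        A₁ ^ (r - t₂) ≤
            (A₁ ^ (r / 2) *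
              (A₂ ^ (-(t₂ / 2)) *
                (A₃ ^ (t₁ / 2) *
                  (A₄ ^ (-(t₁ / 2)) * A₅ ^ p₁ * A₄ ^ (-(t₁ / 2))) ^ p₂ *
                  A₃ ^ (t₁ / 2)) ^ p₃ *
                A₂ ^ (-(t₂ / 2))) ^ p₄ *
              A₁ ^ (r / 2)) ^ ((r - t₂) / (psiFour p₁ p₂ p₃ p₄ t₁ t₂ - t₂ + r)) := by
  constructor
  · rintro ⟨h₅₄, h₄₃, h₃₂, h₂₁⟩ p₁ p₂ p₃ p₄ t₁ t₂ r hp₁ hp₂ hp₃ hp₄ ht₁ ht₂ hr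
    have g₅₄ := (rpow_neg_one_le_iff h₄ h₅).2 h₅₄
    have g₄₃ := (rpow_neg_one_le_iff h₃ h₄).2 h₄₃
    have g₃₂ := (rpow_neg_one_le_iff h₂ h₃).2 h₃₂
    have g₂₁ := (rpow_neg_one_le_iff h₁ h₂).2 h₂₁
    refine ⟨nestedConj_le h₁ h₂₁ h₃₂ h₄₃ h₅₄ hp₁ hp₂ hp₃ hp₄ ht₁ ht₂ hr,
      nestedConj_le h₂ h₃₂ h₄₃ h₅₄ le_rfl hp₁ hp₂ hp₃ hp₄ ht₁ ht₂ hr,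
      (le_nestedConj_iff h₄ h₃ h₂ h₁ h₁ ..).2 ?_, (le_nestedConj_iff h₅ h₄ h₃ h₂ h₁ ..).2 ?_⟩
    · exact nestedConj_le (h₄.rpow _ _) g₄₃ g₃₂ g₂₁ le_rfl hp₁ hp₂ hp₃ hp₄ ht₁ ht₂ hr
    · exact nestedConj_le (h₅.rpow _ _) g₅₄ g₄₃ g₃₂ g₂₁ hp₁ hp₂ hp₃ hp₄ ht₁ ht₂ hr
  · intro h
    have hs : ∀ s : ℝ, 1 ≤ s → _ := fun s hs =>
      h 1 s 1 1 1 0 1 le_rfl hs le_rfl le_rfl ⟨zero_le_one, le_rfl⟩ ⟨le_rfl, zero_le_one⟩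
        zero_le_one
    refine ⟨?_, ?_, ?_, ?_⟩
    -- The lower bounds by A₁ become upper bounds for the inverses, giving A₅⁻¹ ≤ A₄⁻¹ here and A₄⁻¹
    -- ≤ A₃⁻¹ next.
    · refine (rpow_neg_one_le_iff h₄ h₅).1 (le_of_nestedConj_le (h₅.rpow _ (-1)) (h₄.rpow _ (-1))
        (h₃.rpow _ (-1)) (h₂.rpow _ (-1)) (h₁.rpow _ (-1)) fun s h1 => ?_)
      exact (le_nestedConj_iff h₅ h₄ h₃ h₂ h₁ ..).1 (hs s h1).2.2.2
    · refine (rpow_neg_one_le_iff h₃ h₄).1 (le_of_nestedConj_le (h₄.rpow _ (-1)) (h₃.rpow _ (-1))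
        (h₂.rpow _ (-1)) (h₁.rpow _ (-1)) (h₁.rpow _ (-1)) fun s h1 => ?_)
      exact (le_nestedConj_iff h₄ h₃ h₂ h₁ h₁ ..).1 (hs s h1).2.2.1
    · exact le_of_nestedConj_le h₂ h₃ h₄ h₅ h₅ fun s h1 => (hs s h1).2.1
    · exact le_of_nestedConj_le h₁ h₂ h₃ h₄ h₅ fun s h1 => (hs s h1).1
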